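/- Let $p$ be a prime. Groups here are topological groups and subgroups are closed. For a pro-$p$ group $H$, let $\Phi(H)$ be its Frattini subgroup (the intersection of its maximal subgroups) and $[H,H]$ its commutator subgroup (the closed subgroup generated by all commutators). For pro-$p$ groups $H\le K\le G$, the triple $(G,K,H)$ is called \emph{hierarchical} if every $x\in G$ with $x^p\in H$ lies in $K$. A pro-$p$ group $G$ is called \emph{strongly commutator-resistant} if $(H,\Phi(H),[H,H])$ is a hierarchical triple for every closed subgroup $H$ of $G$, and \emph{strongly Frattini-resistant} if $(G,H,\Phi(H))$ is a hierarchical triple for every closed subgroup $H$ of $G$. A pro-$p$ group $F$ is \emph{free} if there is a family $(e_x)_{x\in X}$ in $F$ converging to $1$ (every neighbourhood of $1$ contains all but finitely many of the $e_x$, counted with their indices) such that, for every pro-$p$ group $P$ and every family $(a_x)_{x\in X}$ in $P$ converging to $1$, there is a unique continuous homomorphism $\varphi\colon F\to P$ with $\varphi(e_x)=a_x$ for all $x\in X$. \textbf{Theorem.} Every free pro-$p$ group (of arbitrary, possibly infinite, rank) is strongly commutator-resistant, and it is also strongly Frattini-resistant. -/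

import Mathlib

open Filter Topology

/-- A topological group `G` is a pro-`p` group if it is profinite (compact, Hausdorff and totally
disconnected) and every open normal subgroup has index a power of `p`. -/
structure IsProP (p : ℕ) (G : Type*) [Group G] [TopologicalSpace G] : Prop where
  isTopologicalGroup : IsTopologicalGroup G
  compactSpace : CompactSpace G
  t2Space : T2Space G
  totallyDisconnectedSpace : TotallyDisconnectedSpace G
  index_eq_pow : ∀ N : Subgroup G, N.Normal → IsOpen (N : Set G) → ∃ n : ℕ, N.index = p ^ n

/-- `F` is a free pro-`p` group on the family `ι : X → F`: the group `F` is pro-`p`, the family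
converges to `1` (every neighbourhood of `1` contains `ι x` for all but finitely many `x`), and
every family `X → P` in a pro-`p` group `P` that converges to `1` extends uniquely along `ι` to a
continuous homomorphism `F → P`. -/
structure IsFreeProPOn.{u} (p : ℕ) {F : Type u} [Group F] [TopologicalSpace F]
    {X : Type u} (ι : X → F) : Prop where
  isProP : IsProP p F
  tendsto_one : Tendsto ι cofinite (𝓝 1)
  existsUnique_lift : ∀ (P : Type u) [Group P] [TopologicalSpace P], IsProP p P →
    ∀ f : X → P, Tendsto f cofinite (𝓝 1) → ∃! φ : F →ₜ* P, ∀ x, φ (ι x) = f x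

/-- `F` is a free pro-`p` group (of arbitrary, possibly infinite, rank). -/
def IsFreeProP.{u} (p : ℕ) (F : Type u) [Group F] [TopologicalSpace F] : Prop :=
  ∃ (X : Type u) (ι : X → F), IsFreeProPOn p ι

/-- A maximal subgroup of a topological group in the topological sense: maximal among the proper
closed subgroups. -/
def IsMaximalClosedSubgroup {G : Type*} [Group G] [TopologicalSpace G] (M : Subgroup G) : Prop :=
  Maximal (fun N : Subgroup G => IsClosed (N : Set G) ∧ N ≠ ⊤) M

/-- The Frattini subgroup `Φ(G)`: the intersection of all maximal (closed) subgroups of `G`. -/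
def topFrattini (G : Type*) [Group G] [TopologicalSpace G] : Subgroup G :=
  sInf {M : Subgroup G | IsMaximalClosedSubgroup M}

/-- The commutator subgroup `[G, G]` of a topological group: the closed subgroup generated by
all commutators. -/
def topCommutator (G : Type*) [Group G] [TopologicalSpace G] [IsTopologicalGroup G] :
    Subgroup G :=
  (commutator G).topologicalClosure

/-- `(G, K, H)` is a hierarchical triple, for subgroups `H ≤ K` of `G`: whenever `x ∈ G` and
`x ^ p ∈ H`, then `x ∈ K`. -/
def IsHierarchicalTriple (p : ℕ) {G : Type*} [Group G] (K H : Subgroup G) : Prop :=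
  H ≤ K ∧ ∀ x : G, x ^ p ∈ H → x ∈ K

/-- `G` is strongly commutator-resistant: `(H, Φ(H), [H, H])` is a hierarchical triple for every
closed subgroup `H` of `G`. -/
def IsStronglyCommutatorResistant (p : ℕ) (G : Type*) [Group G] [TopologicalSpace G]
    [IsTopologicalGroup G] : Prop :=
  ∀ H : Subgroup G, IsClosed (H : Set G) →
    IsHierarchicalTriple p (topFrattini H) (topCommutator H)

/-- `G` is strongly Frattini-resistant: `(G, H, Φ(H))` is a hierarchical triple for every closed
subgroup `H` of `G`. -/
def IsStronglyFrattiniResistant (p : ℕ) (G : Type*) [Group G] [TopologicalSpace G] : Prop :=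
  ∀ H : Subgroup G, IsClosed (H : Set G) →
    IsHierarchicalTriple p H ((topFrattini H).map H.subtype)

/-! Both claims rest on one fact: a continuous character χ of order p on a closed subgroup of a free
pro-p group has a companion ψ with values in ℤ/p² such that ψ(x)^p = 1 exactly when χ(x) = 1
(`IsFreeProPOn.exists_hom_zmod_sq`). If x ∉ Φ(H), some χ has χ(x) ≠ 1, so ψ(x^p) ≠ 1, while ψ kills
[H,H]. If x ∉ H, take χ on the closure K of ⟨H, x⟩ that kills H but not x; then ψ maps H into the
p-torsion of ℤ/p², hence kills Φ(H), but not x^p.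

Freeness of closed subgroups is not needed to find ψ. The character factors through the image S of
the subgroup in a finite quotient Q of F and induces a monomial representation of Q. Its pullback to
F lifts, by the universal property, to monomial matrices with entries in ℤ/p²; the entry at the base
coset, restricted to the subgroup, is ψ. -/

/-- A finite `p`-group, with the discrete topology, is pro-`p`. -/
theorem IsPGroup.isProP {p : ℕ} [Fact p.Prime] {E : Type*} [Group E] [TopologicalSpace E]
    [DiscreteTopology E] [Finite E] (hE : IsPGroup p E) : IsProP p E where
  isTopologicalGroup := inferInstance
  compactSpace := inferInstance
  t2Space := inferInstance
  totallyDisconnectedSpace := inferInstance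
  index_eq_pow N _ _ := hE.index N

/-- Quotients of a pro-`p` group by open normal subgroups are finite `p`-groups. -/
theorem IsProP.finite_quotient {p : ℕ} {G : Type*} [Group G] [TopologicalSpace G]
    (hG : IsProP p G) (V : Subgroup G) (hV : IsOpen (V : Set G)) : Finite (G ⧸ V) := by
  have := hG.isTopologicalGroup
  have := hG.compactSpace
  exact V.quotient_finite_of_isOpen hV

theorem IsProP.isPGroup_quotient {p : ℕ} {G : Type*} [Group G] [TopologicalSpace G]
    (hG : IsProP p G) (V : Subgroup G) [V.Normal] (hV : IsOpen (V : Set G)) :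
    IsPGroup p (G ⧸ V) := by
  obtain ⟨n, hn⟩ := hG.index_eq_pow V inferInstance hV
  exact IsPGroup.of_card (n := n) hn

/-- Every neighbourhood of `1` in a pro-`p` group contains an open normal subgroup. -/
theorem IsProP.exists_normal_subset {p : ℕ} {G : Type*} [Group G] [TopologicalSpace G]
    (hG : IsProP p G) {U : Set G} (hU : IsOpen U) (h1 : 1 ∈ U) :
    ∃ V : Subgroup G, V.Normal ∧ IsOpen (V : Set G) ∧ (V : Set G) ⊆ U := by
  have := hG.isTopologicalGroup
  have := hG.compactSpace
  have := hG.t2Space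
  have := hG.totallyDisconnectedSpace
  obtain ⟨V, hV⟩ := ProfiniteGrp.exist_openNormalSubgroup_sub_open_nhds_of_one hU h1
  exact ⟨V.toSubgroup, V.isNormal', V.isOpen', hV⟩

/-- An open subgroup of a closed subgroup `K` contains the trace on `K` of an open normal subgroup
of the ambient pro-`p` group. -/
theorem IsProP.exists_normal_subgroupOf_le {p : ℕ} {G : Type*} [Group G] [TopologicalSpace G]
    (hG : IsProP p G) {K : Subgroup G} {N : Subgroup K} (hN : IsOpen (N : Set K)) :
    ∃ V : Subgroup G, V.Normal ∧ IsOpen (V : Set G) ∧ V.subgroupOf K ≤ N := by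
  obtain ⟨O, hO, hON⟩ := isOpen_induced_iff.1 hN
  have h1 : (1 : G) ∈ O := by
    have : (1 : K) ∈ ((↑) : K → G) ⁻¹' O := hON ▸ N.one_mem
    simpa using this
  obtain ⟨V, hVn, hVo, hV⟩ := hG.exists_normal_subset hO h1
  refine ⟨V, hVn, hVo, fun x hx => ?_⟩
  have : x ∈ ((↑) : K → G) ⁻¹' O := hV hx
  rw [hON] at this
  exact this

/-- Closed subgroups of pro-`p` groups are pro-`p`. -/
theorem IsProP.subgroup {p : ℕ} [Fact p.Prime] {G : Type*} [Group G] [TopologicalSpace G]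
    (hG : IsProP p G) {K : Subgroup G} (hK : IsClosed (K : Set G)) : IsProP p K := by
  have := hG.isTopologicalGroup
  have := hG.compactSpace
  have := hG.t2Space
  have := hG.totallyDisconnectedSpace
  refine ⟨inferInstance, isCompact_iff_compactSpace.1 hK.isCompact, inferInstance, inferInstance,
    fun N hN hNo => ?_⟩
  obtain ⟨V, hVn, hVo, hVN⟩ := hG.exists_normal_subgroupOf_le hNo
  obtain ⟨n, hn⟩ := hG.index_eq_pow V hVn hVo
  have hdvd : N.index ∣ p ^ n :=
    (Subgroup.index_dvd_of_le hVN).trans (hn ▸ Subgroup.relIndex_dvd_index_of_normal V K)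
  obtain ⟨m, -, hm⟩ := (Nat.dvd_prime_pow Fact.out).1 hdvd
  exact ⟨m, hm⟩

/-! ### Characters of order p and the Frattini subgroup -/

/-- A proper subgroup of a finite `p`-group is killed by a nontrivial homomorphism to `ℤ/p`. -/
theorem IsPGroup.exists_hom_zmod {p : ℕ} [Fact p.Prime] {Q : Type*} [Group Q] [Finite Q]
    (hQ : IsPGroup p Q) {H : Subgroup Q} (hH : H ≠ ⊤) :
    ∃ χ : Q →* Multiplicative (ZMod p), χ ≠ 1 ∧ H ≤ χ.ker := by
  obtain ⟨M, hM, hHM⟩ := (eq_top_or_exists_le_coatom H).resolve_left hH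
  have := hQ.isNilpotent
  have hMn : M.Normal := 
    Subgroup.NormalizerCondition.normal_of_coatom _ Group.normalizerCondition_of_isNilpotent hM
  have hQM : IsPGroup p (Q ⧸ M) := hQ.to_quotient M
  have hnt : Nontrivial (Q ⧸ M) := QuotientGroup.nontrivial_iff.2 hM.1
  obtain ⟨n, hn0, hn⟩ := hQM.nontrivial_iff_card.1 hnt
  obtain ⟨y, hy⟩ := exists_prime_orderOf_dvd_card' (G := Q ⧸ M) p
    (hn ▸ dvd_pow_self p hn0.ne')
  have hgen : Subgroup.zpowers y = ⊤ := by
    have hle : M ≤ (Subgroup.zpowers y).comap (QuotientGroup.mk' M) := by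
      intro m hm
      have : (QuotientGroup.mk' M) m = 1 := (QuotientGroup.eq_one_iff m).2 hm
      simp [Subgroup.mem_comap, this, one_mem]
    rcases hM.le_iff.1 hle with h | h
    · rw [← Subgroup.comap_top (QuotientGroup.mk' M)] at h
      exact Subgroup.comap_injective (QuotientGroup.mk'_surjective M) h
    · exfalso
      have hb : Subgroup.zpowers y = ⊥ := by
        apply Subgroup.comap_injective (QuotientGroup.mk'_surjective M)
        rw [h, MonoidHom.comap_bot, QuotientGroup.ker_mk']
      rw [Subgroup.zpowers_eq_bot] at hb
      rw [hb, orderOf_one] at hy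
      exact (Fact.out : p.Prime).one_lt.ne hy
  have hcard : Nat.card (Q ⧸ M) = p := by
    rw [← hy, ← Nat.card_zpowers, hgen, Subgroup.card_top]
  let e : Q ⧸ M ≃* Multiplicative (ZMod p) := mulEquivOfPrimeCardEq (p := p) hcard (by simp)
  refine ⟨e.toMonoidHom.comp (QuotientGroup.mk' M), fun h => ?_, fun x hx => ?_⟩
  · obtain ⟨z, hz⟩ := exists_ne (1 : Q ⧸ M)
    obtain ⟨x, rfl⟩ := QuotientGroup.mk'_surjective M z
    have hx := DFunLike.congr_fun h x
    exact hz (e.injective (by simpa using hx))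
  · rw [MonoidHom.mem_ker, MonoidHom.comp_apply,
      show QuotientGroup.mk' M x = 1 from (QuotientGroup.eq_one_iff x).2 (hHM hx), map_one]

/-- A homomorphism that factors through an open normal subgroup has open kernel. -/
theorem isOpen_ker_comp_mk' {G A : Type*} [Group G] [TopologicalSpace G] [IsTopologicalGroup G]
    [Group A] (V : Subgroup G) [V.Normal] (hV : IsOpen (V : Set G)) (χ : G ⧸ V →* A) :
    IsOpen ((χ.comp (QuotientGroup.mk' V)).ker : Set G) := by
  refine Subgroup.isOpen_mono (H₁ := V) (fun x hx => ?_) hV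
  rw [MonoidHom.mem_ker, MonoidHom.comp_apply,
    show QuotientGroup.mk' V x = 1 from (QuotientGroup.eq_one_iff x).2 hx, map_one]

/-- A proper closed subgroup of a pro-`p` group is killed by a nontrivial continuous homomorphism
to `ℤ/p`. -/
theorem IsProP.exists_hom_zmod {p : ℕ} [Fact p.Prime] {G : Type*} [Group G] [TopologicalSpace G]
    (hG : IsProP p G) {H : Subgroup G} (hHc : IsClosed (H : Set G)) (hH : H ≠ ⊤) :
    ∃ χ : G →* Multiplicative (ZMod p), IsOpen (χ.ker : Set G) ∧ χ ≠ 1 ∧ H ≤ χ.ker := by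
  have := hG.isTopologicalGroup
  obtain ⟨y, hy⟩ : ∃ y, y ∉ H := by
    by_contra! h
    exact hH ((Subgroup.eq_top_iff' H).2 h)
  -- V is so small that yV misses H, so the image of H in G/V is still proper.
  obtain ⟨V, hVn, hVo, hV⟩ := hG.exists_normal_subset (U := (y * ·) ⁻¹' (H : Set G)ᶜ)
    (hHc.isOpen_compl.preimage (by fun_prop)) (by simpa using hy)
  have := hG.finite_quotient V hVo
  obtain ⟨χ, hχ, hHχ⟩ := (hG.isPGroup_quotient V hVo).exists_hom_zmod
    (H := H.map (QuotientGroup.mk' V)) (fun h => by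
      have hy' : QuotientGroup.mk' V y ∈ H.map (QuotientGroup.mk' V) := h ▸ Subgroup.mem_top _
      obtain ⟨h, hh, hhy⟩ := hy'
      have hmem : y⁻¹ * h ∈ V := QuotientGroup.eq.1 hhy.symm
      exact hV hmem (by simpa using hh))
  refine ⟨χ.comp (QuotientGroup.mk' V), isOpen_ker_comp_mk' V hVo χ, fun h => hχ ?_,
    fun x hx => hHχ (Subgroup.mem_map_of_mem _ hx)⟩
  exact MonoidHom.cancel_right (QuotientGroup.mk'_surjective V) |>.1 h

/-- The Frattini subgroup lies in every open normal subgroup of index dividing `p`. -/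
theorem topFrattini_le_of_index_dvd {p : ℕ} (hp : p.Prime) {G : Type*} [Group G]
    [TopologicalSpace G] [IsTopologicalGroup G] {N : Subgroup G} (hN : IsOpen (N : Set G))
    (hi : N.index ∣ p) : topFrattini G ≤ N := by
  by_cases h : N = ⊤
  · simp [h]
  refine sInf_le ⟨⟨N.isClosed_of_isOpen hN, h⟩, fun M hM hNM => ?_⟩
  have hNp : N.index = p :=
    ((Nat.dvd_prime hp).1 hi).resolve_left (fun h1 => h (Subgroup.index_eq_one.1 h1))
  have hmul := Subgroup.relIndex_mul_index hNM
  rw [hNp] at hmul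
  have hM1 : M.index ≠ 1 := fun h1 => hM.2 (Subgroup.index_eq_one.1 h1)
  have hMp := ((Nat.dvd_prime hp).1 (Dvd.intro_left _ hmul)).resolve_left hM1
  rw [hMp] at hmul
  have : N.relIndex M = 1 := Nat.eq_of_mul_eq_mul_right hp.pos (by rw [hmul, one_mul])
  exact Subgroup.relIndex_eq_one.1 this

/-- Elements outside the Frattini subgroup of a pro-`p` group are detected by continuous
homomorphisms to `ℤ/p`. -/
theorem IsProP.exists_hom_zmod_apply_ne_one {p : ℕ} [Fact p.Prime] {G : Type*} [Group G]
    [TopologicalSpace G] (hG : IsProP p G) {x : G} (hx : x ∉ topFrattini G) :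
    ∃ χ : G →* Multiplicative (ZMod p), IsOpen (χ.ker : Set G) ∧ χ x ≠ 1 := by
  have := hG.isTopologicalGroup
  simp only [topFrattini, Subgroup.mem_sInf, not_forall] at hx
  obtain ⟨M, hM, hxM⟩ := hx
  obtain ⟨χ, hχo, hχ, hMχ⟩ := hG.exists_hom_zmod hM.1.1 hM.1.2
  refine ⟨χ, hχo, fun h => hxM (hM.2 ⟨χ.ker.isClosed_of_isOpen hχo, ?_⟩ hMχ h)⟩
  rwa [Ne, MonoidHom.ker_eq_top_iff]

/-- A homomorphism with open kernel to a commutative group kills the closed commutator subgroup. -/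
theorem topCommutator_le_ker {G A : Type*} [Group G] [TopologicalSpace G] [IsTopologicalGroup G]
    [CommGroup A] (χ : G →* A) (hχ : IsOpen (χ.ker : Set G)) : topCommutator G ≤ χ.ker :=
  Subgroup.topologicalClosure_minimal _ (Abelianization.commutator_subset_ker χ)
    (χ.ker.isClosed_of_isOpen hχ)

/-! ### Lifting for the free group itself -/

/-- Free pro-`p` groups have the lifting property for surjections of finite `p`-groups. -/
theorem IsFreeProPOn.exists_lift.{u} {p : ℕ} [Fact p.Prime] {F X : Type u} [Group F]
    [TopologicalSpace F] {ι : X → F} (hF : IsFreeProPOn p ι) {E E' : Type u} [Group E] [Group E']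
    [Finite E] [Finite E'] (hE : IsPGroup p E) (hE' : IsPGroup p E') {π : E →* E'}
    (hπ : Function.Surjective π) (α : F →* E') (hα : IsOpen (α.ker : Set F)) :
    ∃ γ : F →* E, IsOpen (γ.ker : Set F) ∧ π.comp γ = α := by
  have := hF.isProP.isTopologicalGroup
  let _ : TopologicalSpace E := ⊥
  let _ : TopologicalSpace E' := ⊥
  have : DiscreteTopology E := ⟨rfl⟩
  have : DiscreteTopology E' := ⟨rfl⟩
  -- The set-theoretic section must send 1 to 1, so that the lifted family still converges to 1.
  have hs : ∀ y : E', ∃ e : E, π e = y ∧ (y = 1 → e = 1) := fun y => by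
    by_cases hy : y = 1
    · exact ⟨1, by simp [hy], fun _ => rfl⟩
    · obtain ⟨e, he⟩ := hπ y
      exact ⟨e, he, fun h => absurd h hy⟩
  choose s hs hs1 using hs
  have hev : ∀ᶠ x in cofinite, α (ι x) = 1 := hF.tendsto_one (hα.mem_nhds α.ker.one_mem)
  obtain ⟨φ, hφ, -⟩ := hF.existsUnique_lift E hE.isProP (fun x => s (α (ι x)))
    (tendsto_nhds_of_eventually_eq (hev.mono fun x hx => hs1 _ hx))
  have hcont : Continuous α := by
    refine continuous_of_continuousAt_one α ?_
    rw [ContinuousAt, map_one]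
    exact tendsto_nhds_of_eventually_eq (hα.mem_nhds α.ker.one_mem)
  let α' : F →ₜ* E' := ⟨α, hcont⟩
  let π' : E →ₜ* E' := ⟨π, continuous_of_discreteTopology⟩
  have heq : π'.comp φ = α' :=
    (hF.existsUnique_lift E' hE'.isProP (fun x => α (ι x))
      (tendsto_nhds_of_eventually_eq hev)).unique
      (fun x => by rw [ContinuousMonoidHom.comp_toFun, hφ]; exact hs _) (fun _ => rfl)
  refine ⟨φ.toMonoidHom, ?_, MonoidHom.ext fun x => DFunLike.congr_fun heq x⟩
  exact (isOpen_discrete ({1} : Set E)).preimage φ.continuous_toFun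

/-! ### Monomial groups and induced representations -/

section Monomial

variable {Q : Type*} [Group Q] (S : Subgroup Q) (A : Type*) [CommGroup A]

/-- The group of monomial transformations with entries in `A`, indexed by the cosets of `S`. -/
abbrev MonomialGroup : Type _ := (Q ⧸ S → A) ⋊[mulAutArrow] Q

theorem MonomialGroup.isPGroup {p : ℕ} [Fact p.Prime] [Finite Q] [Finite A] (hQ : IsPGroup p Q)
    (hA : IsPGroup p A) : IsPGroup p (MonomialGroup S A) := by
  obtain ⟨m, hm⟩ := IsPGroup.iff_card.1 hQ
  obtain ⟨n, hn⟩ := IsPGroup.iff_card.1 hA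
  refine IsPGroup.of_card (n := n * Nat.card (Q ⧸ S) + m) ?_
  rw [SemidirectProduct.card, Nat.card_fun, hm, hn, pow_add, pow_mul]

instance [Finite Q] [Finite A] : Finite (MonomialGroup S A) :=
  Finite.of_equiv _ SemidirectProduct.equivProd.symm

variable {S A}

theorem out_inv_mul_mul_out_mem (g : Q) (ω : Q ⧸ S) : ω.out⁻¹ * (g * (g⁻¹ • ω).out) ∈ S := by
  rw [← QuotientGroup.eq, QuotientGroup.out_eq', ← smul_eq_mul, ← MulAction.Quotient.smul_coe,
    QuotientGroup.out_eq', smul_inv_smul]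

/-- The monomial representation induced from a homomorphism `S → A`. -/
noncomputable def monomialRep (φ : S →* A) : Q →* MonomialGroup S A :=
  MonoidHom.mk' (fun g => ⟨fun ω => φ ⟨_, out_inv_mul_mul_out_mem g ω⟩, g⟩) fun g g' => by
    refine SemidirectProduct.ext (funext fun ω => ?_) rfl
    change φ _ = φ _ * φ _
    rw [← map_mul]
    congr 1
    apply Subtype.ext
    simp only [Subgroup.coe_mul, mul_inv_rev, mul_smul]
    group

/-- The chosen representative of the base coset is an element of S, not necessarily 1, so the entry
is φ of a conjugate of g; commutativity of A removes the conjugation. -/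
theorem monomialRep_left_one (φ : S →* A) (g : S) :
    (monomialRep φ (g : Q)).left ((1 : Q) : Q ⧸ S) = φ g := by
  have hg : (g : Q)⁻¹ • ((1 : Q) : Q ⧸ S) = ((1 : Q) : Q ⧸ S) := by
    rw [MulAction.Quotient.smul_coe, QuotientGroup.eq]
    simp
  have h1 : (((1 : Q) : Q ⧸ S).out) ∈ S := by
    have := QuotientGroup.out_eq' ((1 : Q) : Q ⧸ S)
    rw [eq_comm, QuotientGroup.eq] at this
    simpa using this
  have : (monomialRep φ (g : Q)).left ((1 : Q) : Q ⧸ S) = φ (⟨_, h1⟩⁻¹ * (g * ⟨_, h1⟩)) := by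
    change φ _ = φ _
    congr 1
    apply Subtype.ext
    simp [hg]
  rw [this, map_mul, map_mul, map_inv, mul_comm (φ g), inv_mul_cancel_left]

/-- The functoriality of the monomial group in its entries. -/
def MonomialGroup.map {B : Type*} [CommGroup B] (π : B →* A) :
    MonomialGroup S B →* MonomialGroup S A :=
  SemidirectProduct.map (π.compLeft _) (MonoidHom.id Q) fun g => by ext; rfl

theorem MonomialGroup.map_surjective {B : Type*} [CommGroup B] {π : B →* A}
    (hπ : Function.Surjective π) : Function.Surjective (MonomialGroup.map (S := S) π) := by
  rintro ⟨f, g⟩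
  choose s hs using hπ
  exact ⟨⟨s ∘ f, g⟩, SemidirectProduct.ext (funext fun ω => hs _) rfl⟩

/-- The entry at the base coset, as a homomorphism on elements fixing this coset. -/
def monomialEntry {D : Type*} [Group D] (γ : D →* MonomialGroup S A)
    (hγ : ∀ d, (γ d).right ∈ S) : D →* A :=
  MonoidHom.mk' (fun d => (γ d).left ((1 : Q) : Q ⧸ S)) fun d d' => by
    have hd : ((γ d).right)⁻¹ • ((1 : Q) : Q ⧸ S) = ((1 : Q) : Q ⧸ S) := by
      rw [MulAction.Quotient.smul_coe, QuotientGroup.eq]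
      simpa using hγ d
    change (γ (d * d')).left _ = (γ d).left _ * (γ d').left _
    rw [map_mul]
    change (γ d).left _ * (γ d').left ((γ d).right⁻¹ • _) = _
    rw [hd]

end Monomial

/-! ### Descent of lifting to closed subgroups -/

/-- Closed subgroups of free pro-`p` groups have the lifting property for surjections of finite
commutative `p`-groups. -/
theorem IsFreeProPOn.exists_subgroup_lift.{u} {p : ℕ} [Fact p.Prime] {F X : Type u} [Group F]
    [TopologicalSpace F] {ι : X → F} (hF : IsFreeProPOn p ι) {A B : Type} [CommGroup A]
    [CommGroup B] [Finite A] [Finite B] (hA : IsPGroup p A) (hB : IsPGroup p B) {π : B →* A}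
    (hπ : Function.Surjective π) (H : Subgroup F) (χ : H →* A) (hχ : IsOpen (χ.ker : Set H)) :
    ∃ ψ : H →* B, IsOpen (ψ.ker : Set H) ∧ π.comp ψ = χ := by
  have hP := hF.isProP
  have := hP.isTopologicalGroup
  obtain ⟨V, hVn, hVo, hV⟩ := hP.exists_normal_subgroupOf_le hχ
  have := hP.finite_quotient V hVo
  have hQ := hP.isPGroup_quotient V hVo
  let q := QuotientGroup.mk' V
  let S := H.map q
  have hqs : Function.Surjective (q.subgroupMap H) := q.subgroupMap_surjective H
  have hker : (q.subgroupMap H).ker ≤ χ.ker := fun x hx => hV <| by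
    have : q x = 1 := congrArg Subtype.val (MonoidHom.mem_ker.1 hx)
    exact (QuotientGroup.eq_one_iff (x : F)).1 this
  let φ : S →* A := MonoidHom.liftOfSurjective _ hqs ⟨χ, hker⟩
  have hφ : ∀ x : H, φ (q.subgroupMap H x) = χ x := fun x =>
    MonoidHom.liftOfRightInverse_comp_apply _ _ (Function.rightInverse_surjInv hqs) ⟨χ, hker⟩ x
  obtain ⟨γ, hγo, hγ⟩ := hF.exists_lift (MonomialGroup.isPGroup S B hQ hB)
    (MonomialGroup.isPGroup S A hQ hA) (MonomialGroup.map_surjective hπ)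
    ((monomialRep φ).comp q) (isOpen_ker_comp_mk' V hVo _)
  have hγ' : ∀ x, MonomialGroup.map π (γ x) = monomialRep φ (q x) := DFunLike.congr_fun hγ
  -- Changing entries leaves the Q-component alone, so γ sends H to elements fixing the base coset,
  -- where the entry is multiplicative.
  have hright : ∀ x : F, (γ x).right = q x := fun x => congrArg SemidirectProduct.right (hγ' x)
  refine ⟨monomialEntry (γ.comp H.subtype) fun x => ?_, ?_, ?_⟩
  · rw [MonoidHom.comp_apply, hright]
    exact Subgroup.mem_map_of_mem q x.2
  · refine Subgroup.isOpen_mono (H₁ := γ.ker.subgroupOf H) (fun x hx => ?_)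
      (hγo.preimage continuous_subtype_val)
    have hx' : γ x = 1 := hx
    change (γ x).left _ = 1
    rw [hx']
    rfl
  · ext x
    have := congrArg (fun z => z.left ((1 : F ⧸ V) : (F ⧸ V) ⧸ S)) (hγ' x)
    rw [← hφ x]
    exact this.trans (monomialRep_left_one φ (q.subgroupMap H x))

/-- A continuous character of order `p` of a closed subgroup of a free pro-`p` group lifts to a
character to `ℤ/p²`. -/
theorem IsFreeProPOn.exists_hom_zmod_sq.{u} {p : ℕ} [Fact p.Prime] {F X : Type u} [Group F]
    [TopologicalSpace F] {ι : X → F} (hF : IsFreeProPOn p ι) (H : Subgroup F)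
    (χ : H →* Multiplicative (ZMod p)) (hχ : IsOpen (χ.ker : Set H)) :
    ∃ ψ : H →* Multiplicative (ZMod (p ^ 2)), IsOpen (ψ.ker : Set H) ∧
      ∀ x, ψ x ^ p = 1 ↔ χ x = 1 := by
  have hp : p.Prime := Fact.out
  have : NeZero (p ^ 2) := ⟨pow_ne_zero _ hp.ne_zero⟩
  have hdvd : p ∣ p ^ 2 := dvd_pow_self p two_ne_zero
  let π := AddMonoidHom.toMultiplicative (ZMod.castHom hdvd (ZMod p)).toAddMonoidHom
  have hπ : Function.Surjective π := ZMod.castHom_surjective hdvd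
  -- The p-torsion of ℤ/p² is the kernel of reduction mod p: p² divides pn iff p divides n.
  have hmem : ∀ b : Multiplicative (ZMod (p ^ 2)), b ^ p = 1 ↔ π b = 1 := fun b => by
    obtain ⟨n, hn⟩ := ZMod.natCast_zmod_surjective (n := p ^ 2) b.toAdd
    have h1 : b ^ p = 1 ↔ ((p * n : ℕ) : ZMod (p ^ 2)) = 0 := by
      rw [Nat.cast_mul, hn, ← nsmul_eq_mul]
      rfl
    have h2 : π b = 1 ↔ (n : ZMod p) = 0 := by
      rw [← map_natCast (ZMod.castHom hdvd (ZMod p)) n, hn]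
      rfl
    rw [h1, h2, ZMod.natCast_eq_zero_iff, ZMod.natCast_eq_zero_iff, sq,
      Nat.mul_dvd_mul_iff_left hp.pos]
  obtain ⟨ψ, hψ, hψχ⟩ := hF.exists_subgroup_lift
    (IsPGroup.of_card (n := 1) (by simp)) (IsPGroup.of_card (n := 2) (by simp)) hπ H χ hχ
  exact ⟨ψ, hψ, fun x => by rw [hmem, ← hψχ]; rfl⟩

/-! ### The two resistance properties -/

theorem IsFreeProPOn.isStronglyCommutatorResistant.{u} {p : ℕ} [Fact p.Prime] {F X : Type u}
    [Group F] [TopologicalSpace F] [IsTopologicalGroup F] {ι : X → F} (hF : IsFreeProPOn p ι) :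
    IsStronglyCommutatorResistant p F := by
  intro H hH
  have hP := hF.isProP.subgroup hH
  refine ⟨fun y hy => ?_, fun x hx => ?_⟩
  · by_contra h
    obtain ⟨χ, hχ, hχy⟩ := hP.exists_hom_zmod_apply_ne_one h
    exact hχy (topCommutator_le_ker χ hχ hy)
  · by_contra h
    obtain ⟨χ, hχ, hχx⟩ := hP.exists_hom_zmod_apply_ne_one h
    obtain ⟨ψ, hψ, hψχ⟩ := hF.exists_hom_zmod_sq H χ hχ
    have := MonoidHom.mem_ker.1 (topCommutator_le_ker ψ hψ hx)
    rw [map_pow, hψχ] at this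
    exact hχx this

/-- The Frattini subgroup is killed by homomorphisms with open kernel to `ℤ/p²` whose values have
order dividing `p`. -/
theorem topFrattini_le_ker_of_pow_eq_one {p : ℕ} [Fact p.Prime] {G : Type*} [Group G]
    [TopologicalSpace G] [IsTopologicalGroup G] (ψ : G →* Multiplicative (ZMod (p ^ 2)))
    (hψ : IsOpen (ψ.ker : Set G)) (hp : ∀ x, ψ x ^ p = 1) : topFrattini G ≤ ψ.ker := by
  have hpp : p.Prime := Fact.out
  refine topFrattini_le_of_index_dvd hpp hψ ?_
  rw [Subgroup.index_ker]
  have : NeZero (p ^ 2) := ⟨pow_ne_zero _ hpp.ne_zero⟩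
  -- The image of ψ is cyclic, so its order is its exponent, which divides p.
  rw [← IsCyclic.exponent_eq_card]
  refine Monoid.exponent_dvd_of_forall_pow_eq_one ?_
  rintro ⟨_, x, rfl⟩
  exact Subtype.ext (hp x)

theorem IsFreeProPOn.isStronglyFrattiniResistant.{u} {p : ℕ} [Fact p.Prime] {F X : Type u}
    [Group F] [TopologicalSpace F] {ι : X → F} (hF : IsFreeProPOn p ι) :
    IsStronglyFrattiniResistant p F := by
  have := hF.isProP.isTopologicalGroup
  intro H hH
  refine ⟨Subgroup.map_subtype_le _, fun x hx => ?_⟩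
  by_contra hxH
  let K := (H ⊔ Subgroup.zpowers x).topologicalClosure
  have hKc : IsClosed (K : Set F) := Subgroup.isClosed_topologicalClosure _
  have hHK : H ≤ K := le_sup_left.trans (Subgroup.le_topologicalClosure _)
  have hxK : x ∈ K := Subgroup.le_topologicalClosure _
    (Subgroup.mem_sup_right (Subgroup.mem_zpowers x))
  obtain ⟨χ, hχo, hχ, hHχ⟩ := (hF.isProP.subgroup hKc).exists_hom_zmod (H := H.subgroupOf K)
    (hH.preimage continuous_subtype_val) (fun h => hxH (Subgroup.subgroupOf_eq_top.1 h hxK))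
  -- If χ killed x as well as H, its closed kernel would be all of K.
  have hχx : χ ⟨x, hxK⟩ ≠ 1 := fun h => hχ <| by
    have hmap : IsClosed ((χ.ker.map K.subtype : Subgroup F) : Set F) :=
      hKc.isClosedEmbedding_subtypeVal.isClosedMap _ (χ.ker.isClosed_of_isOpen hχo)
    have hle : K ≤ χ.ker.map K.subtype := by
      refine Subgroup.topologicalClosure_minimal _ (sup_le (fun y hy => ?_) ?_) hmap
      · exact ⟨⟨y, hHK hy⟩, hHχ hy, rfl⟩
      · rw [Subgroup.zpowers_le]
        exact ⟨⟨x, hxK⟩, h, rfl⟩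
    ext y
    obtain ⟨z, hz, hzy⟩ := hle y.2
    obtain rfl : z = y := Subtype.ext hzy
    exact congrArg _ hz
  obtain ⟨ψ, hψo, hψ⟩ := hF.exists_hom_zmod_sq K χ hχo
  have hle : topFrattini H ≤ (ψ.comp (Subgroup.inclusion hHK)).ker := by
    refine topFrattini_le_ker_of_pow_eq_one _ ?_ fun y => ?_
    · exact hψo.preimage (continuous_inclusion hHK)
    · exact (hψ _).2 (hHχ (by exact y.2))
  obtain ⟨y, hy, hyx⟩ := hx
  have hψy := MonoidHom.mem_ker.1 (hle hy)
  have : Subgroup.inclusion hHK y = ⟨x, hxK⟩ ^ p := Subtype.ext hyx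
  rw [MonoidHom.comp_apply, this, map_pow, hψ] at hψy
  exact hχx hψy

theorem mainTheorem9 (p : ℕ) [Fact p.Prime] (F : Type*) [Group F] [TopologicalSpace F]
    [IsTopologicalGroup F] (hF : IsFreeProP p F) :
    IsStronglyCommutatorResistant p F ∧ IsStronglyFrattiniResistant p F := by
  obtain ⟨X, ι, hι⟩ := hF
  exact ⟨hι.isStronglyCommutatorResistant, hι.isStronglyFrattiniResistant⟩
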